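/- A $0/1$-polytope in $\mathbb R^d$ is the convex hull of a subset of $\{0,1\}^d$; it is full-dimensional if its affine hull is $\mathbb R^d$. Two $0/1$-polytopes in $\mathbb R^d$ are $0/1$-equivalent if one is transformed into the other by a finite sequence of permutations of the coordinates and switchings (replacing some coordinates $x_i$ by $1-x_i$), that is, by a symmetry of the cube $[0,1]^d$. The faces of a polytope $P\subseteq\mathbb R^d$ are the sets $\{x\in P: c^t x=\gamma\}$, where $c\in\mathbb R^d$, $\gamma\in\mathbb R$ and the inequality $c^t x\le\gamma$ holds for all $x\in P$ (so $\emptyset$ and $P$ are faces); two polytopes are combinatorially equivalent if their face lattices (all faces, ordered by inclusion) are isomorphic. Proposition (Sarangarajan–Ziegler). For every integer $d\ge 3$ there is a family $\mathcal F_d$ of exactly $2^{2^{d-1}-4}$ different full-dimensional $0/1$-polytopes in $[0,1]^d$ such that (1) any two polytopes in $\mathcal F_d$ are $0/1$-equivalent if and only if they are combinatorially equivalent, and (2) if $d\ge 6$, then $\mathcal F_d$ contains more than $2^{2^{d-2}}$ pairwise combinatorially non-equivalent ($d$-dimensional) polytopes. -/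

import Mathlib

namespace ZeroOne

/-- The vertices of the unit cube `[0,1]^d`, i.e. the set `{0,1}^d` of all 0/1-vectors. -/
def cubeVertices (d : ℕ) : Set (Fin d → ℝ) :=
  {v | ∀ i, v i = 0 ∨ v i = 1}

/-- A 0/1-polytope in `ℝ^d`: the convex hull of a set of 0/1-vectors. -/
def IsZeroOnePolytope {d : ℕ} (P : Set (Fin d → ℝ)) : Prop :=
  ∃ V : Set (Fin d → ℝ), V ⊆ cubeVertices d ∧ P = convexHull ℝ V

/-- `P ⊆ ℝ^d` is full-dimensional if its affine hull is all of `ℝ^d`. -/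
def IsFullDimensional {d : ℕ} (P : Set (Fin d → ℝ)) : Prop :=
  affineSpan ℝ P = ⊤

/-- Permuting the coordinates. -/
def permuteCoords {d : ℕ} (σ : Equiv.Perm (Fin d)) (x : Fin d → ℝ) : Fin d → ℝ :=
  fun i => x (σ i)

/-- Switching: replacing `x i` by `1 - x i` for the coordinates `i` in `S`. -/
def switchCoords {d : ℕ} (S : Finset (Fin d)) (x : Fin d → ℝ) : Fin d → ℝ :=
  fun i => if i ∈ S then 1 - x i else x i

/-- `Q` arises from `P` by one generating symmetry of the 0/1-cube: a permutation of the
coordinates or a switching. -/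
def CubeStep {d : ℕ} (P Q : Set (Fin d → ℝ)) : Prop :=
  (∃ σ : Equiv.Perm (Fin d), Q = permuteCoords σ '' P) ∨
    (∃ S : Finset (Fin d), Q = switchCoords S '' P)

/-- `P` and `Q` are 0/1-equivalent if a finite sequence of coordinate permutations and
switchings transforms `P` into `Q`. -/
def ZeroOneEquivalent {d : ℕ} (P Q : Set (Fin d → ℝ)) : Prop :=
  Relation.ReflTransGen CubeStep P Q

/-- `F` is a face of `P`: it is cut out of `P` by equality in a linear inequality `c ⬝ᵥ x ≤ γ`
that is valid on `P`. Both `∅` and `P` are faces. -/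
def IsFace {d : ℕ} (P F : Set (Fin d → ℝ)) : Prop :=
  ∃ (c : Fin d → ℝ) (γ : ℝ), (∀ x ∈ P, c ⬝ᵥ x ≤ γ) ∧ F = {x ∈ P | c ⬝ᵥ x = γ}

/-- The face lattice of `P`: all faces, ordered by inclusion. -/
abbrev FaceLattice {d : ℕ} (P : Set (Fin d → ℝ)) : Type :=
  {F : Set (Fin d → ℝ) // IsFace P F}

/-- Combinatorial equivalence: the face lattices are isomorphic. -/
def CombinatoriallyEquivalent {d : ℕ} (P Q : Set (Fin d → ℝ)) : Prop :=
  Nonempty (FaceLattice P ≃o FaceLattice Q)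

end ZeroOne

/-! ### Faces of 0/1-polytopes as vertex sets -/

namespace ZeroOne

variable {d : ℕ}

/-! Put n = d - 1. The polytopes contain the whole cube facet `x 0 = 0` (the bottom) and a set of
vertices of the top facet. In the top, one antipodal pair is always present and another always
absent; the other 2^n - 4 vertices are free, which gives the size of the family. Each antipodal pair
shows both values of every coordinate, which is what `IsCubeBased` asks for.

Such a polytope carries its coordinates in its face lattice. A lattice isomorphism is a bijection of
vertices that respects faces (`exists_vertex_equiv`). The bottom has 2^n vertices and every other
proper face has fewer (`IsCubeBased.ncard_lt`), so bottom goes to bottom. The maximal proper faces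
of the bottom are its ridges (`IsCubeBased.exists_subset_ridge`), so ridges go to ridges. A vertex
satisfies `x (i + 1) = e` exactly when it shares with the ridge of `(i, e)` a face that does not
contain the bottom (`IsCubeBased.apply_succ_eq_iff`). Hence the bijection is a symmetry of the cube
fixing coordinate `0` (`IsCubeBased.exists_symmetry`). Conversely, cube symmetries are affine
bijections and preserve face lattices.

Only n! 2^n such symmetries exist, so combinatorial classes in the family are at most that large,
and dividing gives (2). -/

/-- The cube vertex with the given coordinates. -/
def pt (b : Fin d → Bool) : Fin d → ℝ := fun i => if b i then 1 else 0

/-- The 0/1-polytope spanned by a set of cube vertices. -/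
def polytope (V : Set (Fin d → Bool)) : Set (Fin d → ℝ) := convexHull ℝ (pt '' V)

/-- A set of vertices that is cut out by a valid linear inequality. -/
def IsVertexFace (V : Set (Fin d → Bool)) (S : Set V) : Prop :=
  ∃ (c : Fin d → ℝ) (γ : ℝ), (∀ b : V, c ⬝ᵥ pt b.1 ≤ γ) ∧ S = {b : V | c ⬝ᵥ pt b.1 = γ}

theorem dotProduct_pt (c : Fin d → ℝ) (b : Fin d → Bool) :
    c ⬝ᵥ pt b = ∑ i, if b i then c i else 0 := by
  simp [dotProduct, pt]

theorem convex_setOf_dotProduct_le (c : Fin d → ℝ) (γ : ℝ) : Convex ℝ {x | c ⬝ᵥ x ≤ γ} :=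
  convex_halfSpace_le (f := fun x => c ⬝ᵥ x)
    ⟨fun x y => dotProduct_add c x y, fun a x => dotProduct_smul a c x⟩ γ

theorem polytope_dotProduct_le {V : Set (Fin d → Bool)} {c : Fin d → ℝ} {γ : ℝ}
    (h : ∀ b ∈ V, c ⬝ᵥ pt b ≤ γ) {x : Fin d → ℝ} (hx : x ∈ polytope V) : c ⬝ᵥ x ≤ γ := by
  refine convexHull_min ?_ (convex_setOf_dotProduct_le c γ) hx
  rintro _ ⟨b, hb, rfl⟩
  exact h b hb

theorem pt_mem_polytope_of_mem {V : Set (Fin d → Bool)} {b : Fin d → Bool} (hb : b ∈ V) :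
    pt b ∈ polytope V :=
  subset_convexHull ℝ _ ⟨b, hb, rfl⟩

/-- A face of a polytope is the convex hull of the vertices that it contains. -/
theorem mem_polytope_of_dotProduct_eq {V : Set (Fin d → Bool)} {c : Fin d → ℝ} {γ : ℝ}
    (h : ∀ b ∈ V, c ⬝ᵥ pt b ≤ γ) {x : Fin d → ℝ} (hx : x ∈ polytope V) (hxγ : c ⬝ᵥ x = γ) :
    x ∈ polytope {b ∈ V | c ⬝ᵥ pt b = γ} := by
  set K := polytope {b ∈ V | c ⬝ᵥ pt b = γ} with hK
  have hKc : Convex ℝ K := convex_convexHull ℝ _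
  -- A proper convex combination attains the bound only if both endpoints do, so this set is convex.
  -- It contains the vertices, hence the hull.
  have hconv : Convex ℝ {y | c ⬝ᵥ y ≤ γ ∧ (c ⬝ᵥ y = γ → y ∈ K)} := by
    rintro y ⟨hy, hyK⟩ z ⟨hz, hzK⟩ s t hs ht hst
    have e : c ⬝ᵥ (s • y + t • z) = s * (c ⬝ᵥ y) + t * (c ⬝ᵥ z) := by
      simp [dotProduct_add, dotProduct_smul]
    refine ⟨convex_setOf_dotProduct_le c γ hy hz hs ht hst, fun he => ?_⟩
    rcases hs.eq_or_lt with rfl | hs'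
    · have : t = 1 := by linarith
      subst this
      simp only [zero_smul, one_smul, zero_add] at he ⊢
      exact hzK he
    rcases ht.eq_or_lt with rfl | ht'
    · have : s = 1 := by linarith
      subst this
      simp only [zero_smul, one_smul, add_zero] at he ⊢
      exact hyK he
    have hs1 : s = 1 - t := by linarith
    subst hs1
    refine hKc (hyK ?_) (hzK ?_) hs ht hst
    · by_contra hne
      have := mul_lt_mul_of_pos_left (lt_of_le_of_ne hy hne) hs'
      have := mul_le_mul_of_nonneg_left hz ht
      linarith
    · by_contra hne
      have := mul_lt_mul_of_pos_left (lt_of_le_of_ne hz hne) ht'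
      have := mul_le_mul_of_nonneg_left hy hs
      linarith
  refine (convexHull_min ?_ hconv hx).2 hxγ
  rintro _ ⟨b, hb, rfl⟩
  exact ⟨h b hb, fun hbγ => pt_mem_polytope_of_mem ⟨hb, hbγ⟩⟩

/-- Each cube vertex is the unique maximizer of a linear functional. -/
theorem exists_dotProduct_lt (b : Fin d → Bool) :
    ∃ (c : Fin d → ℝ) (γ : ℝ), c ⬝ᵥ pt b = γ ∧ ∀ b', b' ≠ b → c ⬝ᵥ pt b' < γ := by
  refine ⟨fun i => if b i then 1 else -1, _, rfl, fun b' hb' => ?_⟩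
  rw [dotProduct_pt, dotProduct_pt]
  obtain ⟨i, hi⟩ := Function.ne_iff.1 hb'
  refine Finset.sum_lt_sum (fun j _ => ?_) ⟨i, Finset.mem_univ _, ?_⟩
  · cases b j <;> cases b' j <;> simp
  · revert hi
    cases b i <;> cases b' i <;> simp

/-- The functional maximized only at `b` cuts out a face whose vertices lie in `V`; if `pt b` is in
the hull, that face is nonempty, so its vertex must be `b`. -/
theorem pt_mem_polytope {V : Set (Fin d → Bool)} {b : Fin d → Bool} :
    pt b ∈ polytope V ↔ b ∈ V := by
  refine ⟨fun h => ?_, pt_mem_polytope_of_mem⟩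
  obtain ⟨c, γ, hb, hlt⟩ := exists_dotProduct_lt b
  have hle : ∀ b' ∈ V, c ⬝ᵥ pt b' ≤ γ := fun b' _ => by
    rcases eq_or_ne b' b with rfl | hne
    · exact hb.le
    · exact (hlt b' hne).le
  have h' := mem_polytope_of_dotProduct_eq hle h hb
  obtain ⟨_, b', ⟨hV, hγ⟩, -⟩ := convexHull_nonempty_iff.1 ⟨_, h'⟩
  rcases eq_or_ne b' b with rfl | hne
  · exact hV
  · exact absurd hγ (hlt b' hne).ne

theorem polytope_injective : Function.Injective (polytope (d := d)) := fun V W h => by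
  ext b
  rw [← pt_mem_polytope, h, pt_mem_polytope]

/-- The vertices contained in a face. -/
def vertexSet (V : Set (Fin d → Bool)) (F : Set (Fin d → ℝ)) : Set V := {b | pt b.1 ∈ F}

theorem isVertexFace_vertexSet {V : Set (Fin d → Bool)} {F : Set (Fin d → ℝ)}
    (h : IsFace (polytope V) F) : IsVertexFace V (vertexSet V F) := by
  obtain ⟨c, γ, hle, rfl⟩ := h
  refine ⟨c, γ, fun b => hle _ (pt_mem_polytope_of_mem b.2), ?_⟩
  ext b
  simp [vertexSet, pt_mem_polytope_of_mem b.2]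

theorem face_subset_iff {V : Set (Fin d → Bool)} {F G : Set (Fin d → ℝ)}
    (hF : IsFace (polytope V) F) (hG : IsFace (polytope V) G) :
    vertexSet V F ⊆ vertexSet V G ↔ F ⊆ G := by
  refine ⟨fun h x hx => ?_, fun h b hb => h hb⟩
  obtain ⟨c, γ, hle, rfl⟩ := hF
  obtain ⟨c', γ', hle', rfl⟩ := hG
  refine ⟨hx.1, le_antisymm (hle' _ hx.1) ?_⟩
  have hx' := mem_polytope_of_dotProduct_eq
    (fun b hb => hle _ (pt_mem_polytope_of_mem hb)) hx.1 hx.2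
  -- The vertices of `F` attain the bound of `G`, so the reverse inequality holds on their hull,
  -- which contains `x`.
  have := polytope_dotProduct_le (c := -c') (γ := -γ') (fun b hb => ?_) hx'
  · rw [neg_dotProduct] at this
    linarith
  · have := h (a := ⟨b, hb.1⟩) ⟨pt_mem_polytope_of_mem hb.1, hb.2⟩
    rw [neg_dotProduct, this.2]

theorem exists_face_of_isVertexFace {V : Set (Fin d → Bool)} {S : Set V}
    (h : IsVertexFace V S) : ∃ F, IsFace (polytope V) F ∧ vertexSet V F = S := by
  obtain ⟨c, γ, hle, rfl⟩ := h
  refine ⟨_, ⟨c, γ, fun x hx => polytope_dotProduct_le (fun b hb => hle ⟨b, hb⟩) hx, rfl⟩, ?_⟩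
  ext b
  simp [vertexSet, pt_mem_polytope_of_mem b.2]

/-- The face lattice of a polytope in terms of vertex sets. -/
noncomputable def faceLatticeIso (V : Set (Fin d → Bool)) :
    FaceLattice (polytope V) ≃o {S : Set V // IsVertexFace V S} where
  toEquiv := Equiv.ofBijective (fun F => ⟨vertexSet V F.1, isVertexFace_vertexSet F.2⟩) <| by
    constructor
    · intro F G h
      have h' : vertexSet V F.1 = vertexSet V G.1 := congrArg Subtype.val h
      exact Subtype.ext (((face_subset_iff F.2 G.2).1 h'.subset).antisymm
        ((face_subset_iff G.2 F.2).1 h'.symm.subset))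
    · rintro ⟨S, hS⟩
      obtain ⟨F, hF, rfl⟩ := exists_face_of_isVertexFace hS
      exact ⟨⟨F, hF⟩, rfl⟩
  map_rel_iff' {F G} := face_subset_iff F.2 G.2

/-! ### Recovering vertices from the face lattice -/

theorem isVertexFace_empty (V : Set (Fin d → Bool)) : IsVertexFace V ∅ :=
  ⟨0, 1, by simp, by simp⟩

theorem isVertexFace_singleton {V : Set (Fin d → Bool)} (b : V) : IsVertexFace V {b} := by
  obtain ⟨c, γ, hb, hlt⟩ := exists_dotProduct_lt b.1
  refine ⟨c, γ, fun b' => ?_, ?_⟩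
  · rcases eq_or_ne b' b with rfl | hne
    · exact hb.le
    · exact (hlt b'.1 (Subtype.coe_injective.ne hne)).le
  · ext b'
    simp only [Set.mem_singleton_iff, Set.mem_ofPred_eq]
    refine ⟨fun h => h ▸ hb, fun h => ?_⟩
    by_contra hne
    exact (hlt b'.1 (Subtype.coe_injective.ne hne)).ne h

/-- Singletons are the atoms of the lattice: the preimage of a vertex `w` of the image lies below
`{b}` and is not the empty face, so it is `{b}`. -/
theorem exists_map_singleton {V W : Set (Fin d → Bool)}
    (φ : {S : Set V // IsVertexFace V S} ≃o {S : Set W // IsVertexFace W S}) (b : V) :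
    ∃ w : W, (φ ⟨{b}, isVertexFace_singleton b⟩).1 = {w} := by
  have hne : (φ ⟨{b}, isVertexFace_singleton b⟩).1.Nonempty := by
    by_contra h
    rw [Set.not_nonempty_iff_eq_empty] at h
    have h1 : φ ⟨{b}, isVertexFace_singleton b⟩ ≤ φ ⟨∅, isVertexFace_empty V⟩ := by
      rw [← Subtype.coe_le_coe, h]
      exact Set.empty_subset _
    have h2 : ({b} : Set V) ⊆ ∅ := φ.le_iff_le.1 h1
    exact h2 rfl
  obtain ⟨w, hw⟩ := hne
  refine ⟨w, ?_⟩
  have h1 : φ.symm ⟨{w}, isVertexFace_singleton w⟩ ≤ ⟨{b}, isVertexFace_singleton b⟩ := by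
    rw [OrderIso.symm_apply_le]
    exact Set.singleton_subset_iff.2 hw
  have h2 : (φ.symm ⟨{w}, isVertexFace_singleton w⟩).1 ⊆ {b} := h1
  rcases Set.subset_singleton_iff_eq.1 h2 with h | h
  · exfalso
    have h3 : φ.symm ⟨{w}, isVertexFace_singleton w⟩ ≤ ⟨∅, isVertexFace_empty V⟩ := h.le
    have h4 : φ.symm ⟨{w}, isVertexFace_singleton w⟩ ≤ φ.symm ⟨∅, isVertexFace_empty W⟩ :=
      h3.trans (Set.empty_subset _)
    have h5 : ({w} : Set W) ⊆ ∅ := φ.symm.le_iff_le.1 h4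
    exact h5 rfl
  · have h3 : φ.symm ⟨{w}, isVertexFace_singleton w⟩ = ⟨{b}, isVertexFace_singleton b⟩ :=
      Subtype.ext h
    rw [← h3, OrderIso.apply_symm_apply]

/-- An isomorphism of face lattices is induced by a bijection of the vertices. -/
theorem exists_vertex_equiv {V W : Set (Fin d → Bool)}
    (φ : {S : Set V // IsVertexFace V S} ≃o {S : Set W // IsVertexFace W S}) :
    ∃ f : V ≃ W, ∀ S : Set W, IsVertexFace W S ↔ IsVertexFace V (f ⁻¹' S) := by
  choose f hf using exists_map_singleton φ
  have hmem : ∀ (b : V) (S : {S : Set V // IsVertexFace V S}), f b ∈ (φ S).1 ↔ b ∈ S.1 := by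
    intro b S
    have h := φ.le_iff_le (x := ⟨{b}, isVertexFace_singleton b⟩) (y := S)
    rw [← Subtype.coe_le_coe, ← Subtype.coe_le_coe, hf] at h
    simpa using h
  have hinj : Function.Injective f := fun b b' h => by
    have h' := (hmem b ⟨{b'}, isVertexFace_singleton b'⟩).1 (by rw [hf, h]; rfl)
    exact h'
  have hsurj : Function.Surjective f := fun w => by
    obtain ⟨b, hb⟩ := exists_map_singleton φ.symm w
    refine ⟨b, ?_⟩
    have h1 : φ.symm ⟨{w}, isVertexFace_singleton w⟩ = ⟨{b}, isVertexFace_singleton b⟩ :=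
      Subtype.ext hb
    have h2 := hf b
    rw [← h1, OrderIso.apply_symm_apply] at h2
    exact (Set.singleton_injective h2).symm
  refine ⟨Equiv.ofBijective f ⟨hinj, hsurj⟩, fun S => ⟨fun hS => ?_, fun hS => ?_⟩⟩
  · convert (φ.symm ⟨S, hS⟩).2 using 1
    ext b
    rw [← hmem, OrderIso.apply_symm_apply]
    rfl
  · convert (φ ⟨_, hS⟩).2 using 1
    ext w
    obtain ⟨b, rfl⟩ := hsurj w
    rw [hmem]
    rfl

end ZeroOne

/-! ### Cube-based vertex sets and their faces -/

namespace ZeroOne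

variable {n : ℕ}

/-- Vertex sets of 0/1-polytopes that contain the whole cube facet `x 0 = 0`, while every other
facet of the cube that meets `x 0 = 1` has a vertex there which is present and one which is not. -/
structure IsCubeBased (V : Set (Fin (n + 1) → Bool)) : Prop where
  bottom : ∀ b, b 0 = false → b ∈ V
  exists_mem : ∀ (i : Fin n) (e : Bool), ∃ b ∈ V, b 0 = true ∧ b i.succ = e
  exists_notMem : ∀ (i : Fin n) (e : Bool), ∃ b, b ∉ V ∧ b 0 = true ∧ b i.succ = e

/-- The vertices in the facet `x 0 = 0`. -/
def bottomFace (V : Set (Fin (n + 1) → Bool)) : Set V := {b | b.1 0 = false}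

/-- The vertices in the face `x 0 = 0`, `x (i + 1) = e`. -/
def ridge (V : Set (Fin (n + 1) → Bool)) (i : Fin n) (e : Bool) : Set V :=
  {b | b.1 0 = false ∧ b.1 i.succ = e}

/-- Negation of one coordinate. -/
def flip {d : ℕ} (i : Fin d) (b : Fin d → Bool) : Fin d → Bool := Function.update b i (!b i)

theorem flip_self {d : ℕ} (i : Fin d) (b : Fin d → Bool) : flip i b i = !b i := by simp [flip]

theorem flip_of_ne {d : ℕ} {i j : Fin d} (h : j ≠ i) (b : Fin d → Bool) : flip i b j = b j := by
  simp [flip, h]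

theorem flip_flip {d : ℕ} (i : Fin d) (b : Fin d → Bool) : flip i (flip i b) = b := by
  simp [flip]

theorem dotProduct_flip {d : ℕ} (c : Fin d → ℝ) (i : Fin d) (b : Fin d → Bool) :
    c ⬝ᵥ pt (flip i b) = c ⬝ᵥ pt b + if b i then -c i else c i := by
  rw [dotProduct_pt, dotProduct_pt, ← Finset.add_sum_erase _ _ (Finset.mem_univ i),
    ← Finset.add_sum_erase Finset.univ (fun j => if b j then c j else 0) (Finset.mem_univ i)]
  have : ∑ x ∈ Finset.univ.erase i, (if flip i b x then c x else 0) =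
      ∑ x ∈ Finset.univ.erase i, (if b x then c x else 0) :=
    Finset.sum_congr rfl fun j hj => by rw [flip_of_ne (Finset.ne_of_mem_erase hj)]
  rw [this, flip_self]
  cases b i <;> simp only [Bool.not_false, Bool.not_true, Bool.false_eq_true, if_true, if_false] <;>
    ring

/-- `flip i` splits the cube into 2^n pairs; `T` meets each at most once and misses one entirely. -/
theorem ncard_lt_of_flip (i : Fin (n + 1)) (T : Set (Fin (n + 1) → Bool))
    (hT : ∀ b ∈ T, flip i b ∉ T) {b : Fin (n + 1) → Bool} (hb : b ∉ T) (hb' : flip i b ∉ T) :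
    T.ncard < 2 ^ n := by
  have hinj : Function.Injective (flip i : (Fin (n + 1) → Bool) → _) :=
    Function.LeftInverse.injective (flip_flip i)
  have hdisj : Disjoint T (flip i '' T) := by
    rw [Set.disjoint_left]
    rintro x hx ⟨y, hy, rfl⟩
    exact hT y hy hx
  have h1 : (T ∪ flip i '' T).ncard = 2 * T.ncard := by
    rw [Set.ncard_union_eq hdisj, Set.ncard_image_of_injective _ hinj, two_mul]
  have h2 : (T ∪ flip i '' T).ncard < (Set.univ : Set (Fin (n + 1) → Bool)).ncard := by
    refine Set.ncard_lt_ncard ((Set.ssubset_univ_iff).2 fun h => ?_)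
    rcases h.symm.subset (Set.mem_univ b) with h | ⟨y, hy, h⟩
    · exact hb h
    · exact hb' (h ▸ (flip_flip i y).symm ▸ hy)
  rw [h1, Set.ncard_univ, Nat.card_eq_fintype_card] at h2
  simp [pow_succ] at h2
  omega

theorem dotProduct_pt_of_forall_succ_eq_zero {c : Fin (n + 1) → ℝ} (hc : ∀ i : Fin n, c i.succ = 0)
    (b : Fin (n + 1) → Bool) : c ⬝ᵥ pt b = if b 0 then c 0 else 0 := by
  simp [dotProduct_pt, Fin.sum_univ_succ, hc]

theorem dotProduct_pt_of_forall_ne_eq_zero {c : Fin (n + 1) → ℝ} {i : Fin n}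
    (hc : ∀ j : Fin n, j ≠ i → c j.succ = 0) (b : Fin (n + 1) → Bool) :
    c ⬝ᵥ pt b = (if b 0 then c 0 else 0) + if b i.succ then c i.succ else 0 := by
  rw [dotProduct_pt, Fin.sum_univ_succ, Finset.sum_eq_single i]
  · intro j _ hj
    simp [hc j hj]
  · simp

/-- A linear functional that is constant on a facet of the bottom cube. -/
theorem eq_zero_of_dotProduct_eq_on_ridge {c : Fin (n + 1) → ℝ} {γ : ℝ} {i : Fin n} {e : Bool}
    (h : ∀ b : Fin (n + 1) → Bool, b 0 = false → b i.succ = e → c ⬝ᵥ pt b = γ)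
    (j : Fin n) (hj : j ≠ i) : c j.succ = 0 := by
  let b : Fin (n + 1) → Bool := fun k => if k = i.succ then e else false
  have hji : j.succ ≠ i.succ := (Fin.succ_injective n).ne hj
  have h0 : b 0 = false := by simp [b, (Fin.succ_ne_zero i).symm]
  have h1 : b i.succ = e := by simp [b]
  have h2 : b j.succ = false := by simp [b, hj]
  have e1 := h b h0 h1
  have e2 := h (flip j.succ b) (by rw [flip_of_ne (Fin.succ_ne_zero j).symm, h0])
    (by rw [flip_of_ne hji.symm, h1])
  rw [dotProduct_flip, e1, h2] at e2
  simpa using e2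

variable {V W : Set (Fin (n + 1) → Bool)}

theorem isVertexFace_bottomFace (V : Set (Fin (n + 1) → Bool)) :
    IsVertexFace V (bottomFace V) := by
  have key : ∀ b : Fin (n + 1) → Bool, (Fin.cons (-1) 0 : Fin (n + 1) → ℝ) ⬝ᵥ pt b =
      if b 0 then -1 else 0 := fun b =>
    dotProduct_pt_of_forall_succ_eq_zero (by simp) b
  refine ⟨Fin.cons (-1) 0, 0, fun b => ?_, ?_⟩
  · rw [key]; split_ifs <;> norm_num
  · ext b
    rw [Set.mem_ofPred_eq, key]
    simp [bottomFace]

theorem isVertexFace_ridge (V : Set (Fin (n + 1) → Bool)) (i : Fin n) (e : Bool) :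
    IsVertexFace V (ridge V i e) := by
  have key : ∀ b : Fin (n + 1) → Bool,
      (Fin.cons (-1) (Pi.single i (if e then 1 else -1)) : Fin (n + 1) → ℝ) ⬝ᵥ pt b =
      (if b 0 then -1 else 0) + if b i.succ then (if e then 1 else -1) else 0 := fun b => by
    rw [dotProduct_pt_of_forall_ne_eq_zero (i := i) (fun j hj => by simp [hj])]
    simp
  -- The sum of the inequalities of two cube facets: equality holds in the sum only if it holds in
  -- both.
  refine ⟨Fin.cons (-1) (Pi.single i (if e then 1 else -1)), if e then 1 else 0, fun b => ?_, ?_⟩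
  · rw [key]; split_ifs <;> norm_num
  · ext b
    rw [Set.mem_ofPred_eq, key]
    cases h0 : b.1 0 <;> cases h1 : b.1 i.succ <;> cases e <;> norm_num [ridge, h0, h1]

theorem isVertexFace_facet (V : Set (Fin (n + 1) → Bool)) (i : Fin n) (e : Bool) :
    IsVertexFace V {b | b.1 i.succ = e} := by
  have key : ∀ b : Fin (n + 1) → Bool,
      (Fin.cons 0 (Pi.single i (if e then 1 else -1)) : Fin (n + 1) → ℝ) ⬝ᵥ pt b =
      if b i.succ then (if e then 1 else -1) else 0 := fun b => by
    rw [dotProduct_pt_of_forall_ne_eq_zero (i := i) (fun j hj => by simp [hj])]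
    simp
  refine ⟨Fin.cons 0 (Pi.single i (if e then 1 else -1)), if e then 1 else 0, fun b => ?_, ?_⟩
  · rw [key]; split_ifs <;> norm_num
  · ext b
    rw [Set.mem_ofPred_eq, Set.mem_ofPred_eq, key]
    cases h1 : b.1 i.succ <;> cases e <;> norm_num

/-- A bottom vertex that maximizes a functional has its coordinates chosen by the signs. -/
theorem IsCubeBased.apply_eq_of_dotProduct_eq (hV : IsCubeBased V) {c : Fin (n + 1) → ℝ} {γ : ℝ}
    (hle : ∀ b ∈ V, c ⬝ᵥ pt b ≤ γ) {i : Fin n} (hi : c i.succ ≠ 0) {b : Fin (n + 1) → Bool}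
    (h0 : b 0 = false) (hb : c ⬝ᵥ pt b = γ) : b i.succ = decide (0 < c i.succ) := by
  have h1 := hle (flip i.succ b)
    (hV.bottom _ (by rw [flip_of_ne (Fin.succ_ne_zero i).symm, h0]))
  rw [dotProduct_flip, hb] at h1
  cases h : b i.succ
  · simp only [h] at h1
    simp only [Bool.false_eq_true, if_false] at h1
    symm
    rw [decide_eq_false_iff_not]
    linarith
  · simp only [h, if_true] at h1
    symm
    rw [decide_eq_true_eq]
    exact lt_of_le_of_ne (by linarith) hi.symm

/-- If the functional depends on coordinate `0` only, `S` lies in the top, where a vertex is absent.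
Otherwise some `c i.succ` is nonzero, and `S` contains at most one vertex of each pair under `flip
i.succ`. With 2^n vertices it would meet every pair, hence contain a whole ridge, so `c` involves
only coordinates `0` and `i + 1`; the absent top vertices then contradict `c i.succ ≠ 0`. -/
theorem IsCubeBased.ncard_lt (hV : IsCubeBased V) (hn : 0 < n) {S : Set V}
    (hS : IsVertexFace V S) (hne : S ≠ bottomFace V) (hne' : S ≠ Set.univ) :
    S.ncard < 2 ^ n := by
  obtain ⟨c, γ, hle, rfl⟩ := hS
  set S : Set V := {b : V | c ⬝ᵥ pt b.1 = γ} with hS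
  rw [← Set.ncard_image_of_injective S Subtype.val_injective]
  have hle' : ∀ b ∈ V, c ⬝ᵥ pt b ≤ γ := fun b hb => hle ⟨b, hb⟩
  have hmem : ∀ b, b ∈ Subtype.val '' S ↔ b ∈ V ∧ c ⬝ᵥ pt b = γ := fun b => by
    simp [hS, and_comm]
  by_cases hc : ∀ i : Fin n, c i.succ = 0
  · have hval := dotProduct_pt_of_forall_succ_eq_zero hc
    obtain ⟨v, hvV, hv0, -⟩ := hV.exists_notMem ⟨0, hn⟩ true
    have hγ : γ ≠ 0 := by
      rintro rfl
      by_cases h0 : c 0 = 0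
      · apply hne'
        ext b
        simp [hS, hval, h0]
      · apply hne
        ext b
        simp [hS, hval, h0, bottomFace]
    have hbot : ∀ b, b 0 = false → b ∉ Subtype.val '' S := fun b h0 h => by
      have := ((hmem b).1 h).2
      rw [hval, h0] at this
      exact hγ (by simpa using this.symm)
    refine ncard_lt_of_flip 0 _ (fun b hb => hbot _ ?_) (b := v) (fun h => hvV ((hmem v).1 h).1)
      (hbot _ ?_)
    · rw [flip_self]
      cases h : b 0
      · exact absurd hb (hbot b h)
      · rfl
    · rw [flip_self, hv0]; rfl
  · push Not at hc
    obtain ⟨i, hi⟩ := hc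
    by_contra hcard
    have hflip : ∀ b ∈ Subtype.val '' S, flip i.succ b ∉ Subtype.val '' S := fun b hb hb' => by
      have h1 := ((hmem _).1 hb).2
      have h2 := ((hmem _).1 hb').2
      rw [dotProduct_flip, h1] at h2
      apply hi
      cases h : b i.succ <;> simpa [h] using h2
    have hcover : ∀ b, b ∉ Subtype.val '' S → flip i.succ b ∈ Subtype.val '' S := fun b hb => by
      by_contra hb'
      exact hcard (ncard_lt_of_flip i.succ _ hflip hb hb')
    have hrid : ∀ b : Fin (n + 1) → Bool, b 0 = false → b i.succ = decide (0 < c i.succ) →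
        c ⬝ᵥ pt b = γ := fun b h0 h1 => by
      by_contra hb
      have h2 := hcover b fun h => hb ((hmem b).1 h).2
      have h3 := hV.apply_eq_of_dotProduct_eq hle' hi
        (by rw [flip_of_ne (Fin.succ_ne_zero i).symm, h0]) ((hmem _).1 h2).2
      rw [flip_self, h1] at h3
      simp at h3
    have hval := dotProduct_pt_of_forall_ne_eq_zero (eq_zero_of_dotProduct_eq_on_ridge hrid)
    -- The flip partner of an absent top vertex must lie in `S`; absent vertices exist for both
    -- values of `e`.
    have htop : ∀ e : Bool, c 0 + (if !e then c i.succ else 0) = γ := fun e => by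
      obtain ⟨v, hvV, hv0, hve⟩ := hV.exists_notMem i e
      have h := ((hmem _).1 (hcover v fun h => hvV ((hmem v).1 h).1)).2
      rwa [hval, flip_self, flip_of_ne (Fin.succ_ne_zero i).symm, hv0, hve, if_pos rfl] at h
    have h1 := htop true
    have h2 := htop false
    simp at h1 h2
    exact hi (by linarith)

theorem IsCubeBased.ncard_bottomFace (hV : IsCubeBased V) : (bottomFace V).ncard = 2 ^ n := by
  rw [← Set.ncard_image_of_injective _ Subtype.val_injective]
  have : Subtype.val '' bottomFace V =
      Set.range (fun y : Fin n → Bool => (Fin.cons false y : Fin (n + 1) → Bool)) := by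
    ext b
    simp only [bottomFace, Set.mem_image, Set.mem_ofPred_eq, Subtype.exists, exists_and_left,
      exists_prop, exists_eq_right_right, Set.mem_range]
    constructor
    · rintro ⟨h, -⟩
      exact ⟨Fin.tail b, by rw [← h]; exact Fin.cons_self_tail b⟩
    · rintro ⟨y, rfl⟩
      exact ⟨rfl, hV.bottom _ rfl⟩
  have hinj : Function.Injective
      (fun y : Fin n → Bool => (Fin.cons false y : Fin (n + 1) → Bool)) :=
    Fin.cons_right_injective (α := fun _ => Bool) false
  rw [this, ← Set.image_univ, Set.ncard_image_of_injective _ hinj, Set.ncard_univ,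
    Nat.card_eq_fintype_card]
  simp

theorem IsCubeBased.bottomFace_ne_univ (hV : IsCubeBased V) (hn : 0 < n) :
    bottomFace V ≠ Set.univ := fun h => by
  obtain ⟨v, hvV, hv0, -⟩ := hV.exists_mem ⟨0, hn⟩ true
  have : (⟨v, hvV⟩ : V) ∈ bottomFace V := h ▸ Set.mem_univ _
  simp [bottomFace, hv0] at this

theorem IsCubeBased.ridge_ne_bottomFace (hV : IsCubeBased V) (i : Fin n) (e : Bool) :
    ridge V i e ≠ bottomFace V := fun h => by
  let b : Fin (n + 1) → Bool := Fin.cons false fun _ => !e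
  have hb : (⟨b, hV.bottom b rfl⟩ : V) ∈ bottomFace V := rfl
  rw [← h] at hb
  simpa [b] using hb.2

/-- A functional constant on the bottom cuts out all of it or nothing; otherwise the sign of a
nonzero coefficient fixes that coordinate on `S`. -/
theorem IsCubeBased.exists_subset_ridge (hV : IsCubeBased V) (hn : 0 < n) {S : Set V}
    (hS : IsVertexFace V S) (hsub : S ⊆ bottomFace V) (hne : S ≠ bottomFace V) :
    ∃ i e, S ⊆ ridge V i e := by
  obtain ⟨c, γ, hle, rfl⟩ := hS
  by_cases hc : ∀ i : Fin n, c i.succ = 0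
  · have hval := dotProduct_pt_of_forall_succ_eq_zero hc
    refine ⟨⟨0, hn⟩, true, fun b hb => (hne (hsub.antisymm fun b' hb' => ?_)).elim⟩
    have h1 : c ⬝ᵥ pt b.1 = γ := hb
    have h2 : b.1 0 = false := hsub hb
    have h3 : b'.1 0 = false := hb'
    rw [hval, h2] at h1
    rw [Set.mem_ofPred_eq, hval, h3]
    exact h1
  · push Not at hc
    obtain ⟨i, hi⟩ := hc
    exact ⟨i, _, fun b hb => ⟨hsub hb,
      hV.apply_eq_of_dotProduct_eq (fun b hb => hle ⟨b, hb⟩) hi (hsub hb) hb⟩⟩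

theorem IsCubeBased.eq_of_ridge_subset (hV : IsCubeBased V) {i j : Fin n} {e e' : Bool}
    (h : ridge V i e ⊆ ridge V j e') : i = j ∧ e = e' := by
  let b : Fin (n + 1) → Bool := Fin.cons false fun k => if k = i then e else !e'
  have hb : (⟨b, hV.bottom b rfl⟩ : V) ∈ ridge V i e := ⟨rfl, by simp [b]⟩
  have h' : (if j = i then e else !e') = e' := by simpa [b] using (h hb).2
  split_ifs at h' with hij
  · exact ⟨hij.symm, h'⟩
  · simp at h'

/-- The vertices with a given coordinate, in terms of the face lattice. -/
theorem IsCubeBased.apply_succ_eq_iff (hV : IsCubeBased V) (i : Fin n) (e : Bool) (b : V) :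
    b.1 i.succ = e ↔
      ∃ S, IsVertexFace V S ∧ ridge V i e ⊆ S ∧ ¬ bottomFace V ⊆ S ∧ b ∈ S := by
  constructor
  · intro h
    refine ⟨_, isVertexFace_facet V i e, fun b hb => hb.2, fun hsub => ?_, h⟩
    let b' : Fin (n + 1) → Bool := Fin.cons false fun _ => !e
    have := hsub (a := ⟨b', hV.bottom b' rfl⟩) rfl
    simp [b'] at this
  · rintro ⟨_, ⟨c, γ, hle, rfl⟩, hrid, hbot, hb⟩
    have hval := dotProduct_pt_of_forall_ne_eq_zero (eq_zero_of_dotProduct_eq_on_ridge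
      (c := c) (γ := γ) (i := i) (e := e) fun b h0 h1 => hrid (a := ⟨b, hV.bottom b h0⟩) ⟨h0, h1⟩)
    have hγ : (if e then c i.succ else 0) = γ := by
      let b' : Fin (n + 1) → Bool := Fin.cons false fun _ => e
      have h : c ⬝ᵥ pt b' = γ := hrid (a := ⟨b', hV.bottom b' rfl⟩) ⟨rfl, rfl⟩
      simpa [hval, b'] using h
    have hγ' : (if !e then c i.succ else 0) ≤ γ := by
      let b' : Fin (n + 1) → Bool := Fin.cons false fun _ => !e
      have h := hle ⟨b', hV.bottom b' rfl⟩
      simpa [hval, b'] using h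
    have hi : c i.succ ≠ 0 := fun hi => by
      refine hbot fun b' hb' => ?_
      have h0 : b'.1 0 = false := hb'
      rw [Set.mem_ofPred_eq, hval, h0, hi, ← hγ, hi]
      simp
    -- This present top vertex forces `c 0 ≤ 0`, so vertices with the other value at `i.succ` stay
    -- strictly below `γ`.
    obtain ⟨v, hvV, hv0, hve⟩ := hV.exists_mem i e
    have htop := hle ⟨v, hvV⟩
    have hb' : c ⬝ᵥ pt b.1 = γ := hb
    rw [hval] at htop hb'
    simp only [hv0, hve, if_true] at htop
    by_contra hbe
    have hbe' : b.1 i.succ = !e := by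
      revert hbe
      cases b.1 i.succ <;> cases e <;> simp
    rw [hbe'] at hb'
    apply hi
    cases e <;> cases h0 : b.1 0 <;> simp [h0] at * <;> linarith

/-! ### Face-preserving bijections are cube symmetries -/

/-- The cube symmetry that fixes coordinate `0`, permutes the others by `τ` and switches those
at which `s` is false. -/
def symmetry (τ : Equiv.Perm (Fin n)) (s : Fin n → Bool) (b : Fin (n + 1) → Bool) :
    Fin (n + 1) → Bool :=
  Fin.cons (b 0) fun j => b (τ j).succ == s j

/-- A vertex bijection that preserves faces is a cube symmetry. -/
theorem IsCubeBased.exists_symmetry (hV : IsCubeBased V) (hW : IsCubeBased W) (hn : 0 < n)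
    (f : V ≃ W) (hf : ∀ S : Set W, IsVertexFace W S ↔ IsVertexFace V (f ⁻¹' S)) :
    ∃ τ s, W = symmetry τ s '' V := by
  -- The preimage is a proper face with 2^n vertices, and only the bottom has that many.
  have hbot : f ⁻¹' bottomFace W = bottomFace V := by
    by_contra hne
    have h1 := hV.ncard_lt hn ((hf _).1 (isVertexFace_bottomFace W)) hne fun h =>
      hW.bottomFace_ne_univ hn (f.surjective.preimage_injective (h.trans Set.preimage_univ.symm))
    rw [Set.ncard_preimage_of_injective_subset_range f.injective (by simp [f.surjective.range_eq]),
      hW.ncard_bottomFace] at h1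
    exact h1.false
  have hrid : ∀ j e, ∃ k e', f ⁻¹' ridge W j e = ridge V k e' := by
    intro j e
    obtain ⟨k, e', hk⟩ := hV.exists_subset_ridge hn ((hf _).1 (isVertexFace_ridge W j e))
      (hbot ▸ Set.preimage_mono fun b hb => hb.1)
      (fun h => hW.ridge_ne_bottomFace j e
        (f.surjective.preimage_injective (h.trans hbot.symm)))
    have himg : f ⁻¹' (f '' ridge V k e') = ridge V k e' :=
      Set.preimage_image_eq _ f.injective
    have hsub : f '' ridge V k e' ⊆ bottomFace W := by
      rw [Set.image_subset_iff, hbot]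
      exact fun b hb => hb.1
    -- The image of the ridge of `V` is squeezed between two ridges of `W`, which must coincide.
    obtain ⟨l, e'', hl⟩ := hW.exists_subset_ridge hn
      ((hf _).2 (himg.symm ▸ isVertexFace_ridge V k e')) hsub fun h =>
        hV.ridge_ne_bottomFace k e' (by rw [← himg, h, hbot])
    have hjk : ridge W j e ⊆ f '' ridge V k e' := by
      rw [← f.surjective.image_preimage (ridge W j e)]
      exact Set.image_mono hk
    obtain ⟨rfl, rfl⟩ := hW.eq_of_ridge_subset (hjk.trans hl)
    exact ⟨k, e', hk.antisymm (Set.image_subset_iff.1 hl)⟩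
  choose τ s hτ using fun j => hrid j true
  have hcoord : ∀ (b : V) j, (f b).1 j.succ = true ↔ b.1 (τ j).succ = s j := by
    intro b j
    rw [hW.apply_succ_eq_iff, hV.apply_succ_eq_iff, ← hτ, ← hbot]
    constructor
    · rintro ⟨S, hS, h1, h2, h3⟩
      exact ⟨f ⁻¹' S, (hf S).1 hS, Set.preimage_mono h1,
        fun h => h2 ((Set.preimage_subset_preimage_iff (by simp [f.surjective.range_eq])).1 h), h3⟩
    · rintro ⟨S, hS, h1, h2, h3⟩
      obtain ⟨T, rfl⟩ : ∃ T, f ⁻¹' T = S := ⟨f '' S, Set.preimage_image_eq _ f.injective⟩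
      exact ⟨T, (hf T).2 hS,
        (Set.preimage_subset_preimage_iff (by simp [f.surjective.range_eq])).1 h1,
        fun h => h2 (Set.preimage_mono h), h3⟩
  have hinj : Function.Injective τ := by
    intro j j' hjj
    by_contra hne
    -- If `τ j = τ j'`, one coordinate of `W` would determine the other; this bottom vertex violates
    -- the forced relation.
    let w : Fin (n + 1) → Bool := Fin.cons false fun k => if k = j then true else s j != s j'
    obtain ⟨b, hb⟩ := f.surjective ⟨w, hW.bottom w rfl⟩
    have h1 := hcoord b j
    have h2 := hcoord b j'
    rw [hb] at h1 h2
    simp only [w, Fin.cons_succ, if_true, if_neg (Ne.symm hne), true_iff] at h1 h2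
    rw [← hjj, h1] at h2
    revert h2
    cases s j <;> cases s j' <;> simp
  refine ⟨Equiv.ofBijective τ (Finite.injective_iff_bijective.1 hinj), s, ?_⟩
  have hfb : ∀ b : V, symmetry (Equiv.ofBijective τ (Finite.injective_iff_bijective.1 hinj)) s b.1
      = (f b).1 := by
    intro b
    have h0 : b.1 0 = (f b).1 0 := by
      have h : b ∈ f ⁻¹' bottomFace W ↔ b ∈ bottomFace V := by rw [hbot]
      have h' : (f b).1 0 = false ↔ b.1 0 = false := h
      revert h'
      cases (f b).1 0 <;> cases b.1 0 <;> simp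
    funext k
    refine Fin.cases h0 (fun j => ?_) k
    have h := hcoord b j
    simp only [symmetry, Fin.cons_succ, Equiv.ofBijective_apply]
    revert h
    cases (f b).1 j.succ <;> cases b.1 (τ j).succ <;> cases s j <;> simp
  ext w
  constructor
  · intro hw
    obtain ⟨b, hb⟩ := f.surjective ⟨w, hw⟩
    exact ⟨b.1, b.2, by rw [hfb, hb]⟩
  · rintro ⟨b, hb, rfl⟩
    rw [hfb ⟨b, hb⟩]
    exact (f ⟨b, hb⟩).2

end ZeroOne

/-! ### Cube symmetries preserve the combinatorial type -/

namespace ZeroOne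

variable {d n : ℕ}

theorem CombinatoriallyEquivalent.refl (P : Set (Fin d → ℝ)) : CombinatoriallyEquivalent P P :=
  ⟨OrderIso.refl _⟩

theorem CombinatoriallyEquivalent.symm {P Q : Set (Fin d → ℝ)}
    (h : CombinatoriallyEquivalent P Q) : CombinatoriallyEquivalent Q P :=
  h.map OrderIso.symm

theorem CombinatoriallyEquivalent.trans {P Q R : Set (Fin d → ℝ)}
    (h : CombinatoriallyEquivalent P Q) (h' : CombinatoriallyEquivalent Q R) :
    CombinatoriallyEquivalent P R := by
  obtain ⟨φ⟩ := h
  obtain ⟨ψ⟩ := h'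
  exact ⟨φ.trans ψ⟩

theorem IsFace.image {T T' : (Fin d → ℝ) → Fin d → ℝ} (hT : Function.LeftInverse T' T)
    (haff : ∀ c : Fin d → ℝ, ∃ (c' : Fin d → ℝ) (k : ℝ), ∀ x, c ⬝ᵥ T' x = c' ⬝ᵥ x + k)
    {P F : Set (Fin d → ℝ)} (h : IsFace P F) : IsFace (T '' P) (T '' F) := by
  obtain ⟨c, γ, hle, rfl⟩ := h
  obtain ⟨c', k, hc⟩ := haff c
  have key : ∀ x, c' ⬝ᵥ T x = c ⬝ᵥ x - k := fun x => by
    have := hc (T x)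
    rw [hT x] at this
    linarith
  refine ⟨c', γ - k, ?_, ?_⟩
  · rintro _ ⟨x, hx, rfl⟩
    rw [key]
    linarith [hle x hx]
  · ext y
    constructor
    · rintro ⟨x, ⟨hx, hγ⟩, rfl⟩
      exact ⟨⟨x, hx, rfl⟩, by rw [key, hγ]⟩
    · rintro ⟨⟨x, hx, rfl⟩, hγ⟩
      rw [key] at hγ
      exact ⟨x, ⟨hx, by linarith⟩, rfl⟩

/-- Affine bijections preserve the combinatorial type. -/
theorem combinatoriallyEquivalent_image (T : (Fin d → ℝ) ≃ (Fin d → ℝ))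
    (haff : ∀ c : Fin d → ℝ, ∃ (c' : Fin d → ℝ) (k : ℝ), ∀ x, c ⬝ᵥ T x = c' ⬝ᵥ x + k)
    (haff' : ∀ c : Fin d → ℝ, ∃ (c' : Fin d → ℝ) (k : ℝ), ∀ x, c ⬝ᵥ T.symm x = c' ⬝ᵥ x + k)
    (P : Set (Fin d → ℝ)) : CombinatoriallyEquivalent P (T '' P) := by
  refine ⟨{ toFun := fun F => ⟨T '' F.1, F.2.image T.left_inv haff'⟩
            invFun := fun F => ⟨T.symm '' F.1, ?_⟩
            left_inv := fun F => Subtype.ext (T.symm_image_image F.1)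
            right_inv := fun F => Subtype.ext (T.image_symm_image F.1)
            map_rel_iff' := Set.image_subset_image_iff T.injective }⟩
  have := F.2.image (T := T.symm) (T' := T) T.right_inv haff
  rwa [T.symm_image_image] at this

theorem switchCoords_switchCoords (S : Finset (Fin d)) (x : Fin d → ℝ) :
    switchCoords S (switchCoords S x) = x := by
  funext i
  by_cases h : i ∈ S <;> simp [switchCoords, h]

theorem dotProduct_permuteCoords (σ : Equiv.Perm (Fin d)) (c x : Fin d → ℝ) :
    c ⬝ᵥ permuteCoords σ x = permuteCoords σ.symm c ⬝ᵥ x := by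
  simp only [dotProduct, permuteCoords]
  exact Fintype.sum_equiv σ _ _ (by simp)

theorem dotProduct_switchCoords (S : Finset (Fin d)) (c x : Fin d → ℝ) :
    c ⬝ᵥ switchCoords S x =
      (fun i => if i ∈ S then -c i else c i) ⬝ᵥ x + ∑ i, if i ∈ S then c i else 0 := by
  simp only [dotProduct, switchCoords]
  rw [← Finset.sum_add_distrib]
  refine Finset.sum_congr rfl fun i _ => ?_
  split_ifs <;> ring

theorem CubeStep.combinatoriallyEquivalent {P Q : Set (Fin d → ℝ)} (h : CubeStep P Q) :
    CombinatoriallyEquivalent P Q := by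
  rcases h with ⟨σ, rfl⟩ | ⟨S, rfl⟩
  · exact combinatoriallyEquivalent_image
      ⟨permuteCoords σ, permuteCoords σ.symm,
        fun x => funext fun i => congrArg x (σ.apply_symm_apply i),
        fun x => funext fun i => congrArg x (σ.symm_apply_apply i)⟩
      (fun c => ⟨_, 0, fun x => (dotProduct_permuteCoords σ c x).trans (add_zero _).symm⟩)
      (fun c => ⟨_, 0, fun x => (dotProduct_permuteCoords σ.symm c x).trans (add_zero _).symm⟩) P
  · exact combinatoriallyEquivalent_image
      ⟨switchCoords S, switchCoords S, switchCoords_switchCoords S, switchCoords_switchCoords S⟩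
      (fun c => ⟨_, _, dotProduct_switchCoords S c⟩)
      (fun c => ⟨_, _, dotProduct_switchCoords S c⟩) P

theorem ZeroOneEquivalent.combinatoriallyEquivalent {P Q : Set (Fin d → ℝ)}
    (h : ZeroOneEquivalent P Q) : CombinatoriallyEquivalent P Q := by
  induction h with
  | refl => exact .refl P
  | tail _ h ih => exact ih.trans h.combinatoriallyEquivalent

theorem permuteCoords_image_convexHull (σ : Equiv.Perm (Fin d)) (A : Set (Fin d → ℝ)) :
    permuteCoords σ '' convexHull ℝ A = convexHull ℝ (permuteCoords σ '' A) :=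
  LinearMap.image_convexHull (LinearMap.funLeft ℝ ℝ σ) A

theorem switchCoords_image_convexHull (S : Finset (Fin d)) (A : Set (Fin d → ℝ)) :
    switchCoords S '' convexHull ℝ A = convexHull ℝ (switchCoords S '' A) := by
  let L : (Fin d → ℝ) →ₗ[ℝ] (Fin d → ℝ) :=
    LinearMap.pi fun i => if i ∈ S then -LinearMap.proj i else LinearMap.proj i
  let T : (Fin d → ℝ) →ᵃ[ℝ] (Fin d → ℝ) :=
    L.toAffineMap + AffineMap.const ℝ (Fin d → ℝ) (fun i => if i ∈ S then (1 : ℝ) else 0)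
  have hT : ⇑T = switchCoords S := by
    funext x i
    by_cases h : i ∈ S
    · simp [T, L, switchCoords, h]
      ring
    · simp [T, L, switchCoords, h]
  rw [← hT]
  exact T.image_convexHull A

theorem polytope_symmetry_image (τ : Equiv.Perm (Fin n)) (s : Fin n → Bool)
    (V : Set (Fin (n + 1) → Bool)) :
    ∃ (σ : Equiv.Perm (Fin (n + 1))) (S : Finset (Fin (n + 1))),
      polytope (symmetry τ s '' V) = switchCoords S '' (permuteCoords σ '' polytope V) := by
  -- The leading `true` keeps coordinate `0` unswitched; comparing a bit with `false` negates it.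
  let S : Finset (Fin (n + 1)) :=
    Finset.univ.filter fun k => (Fin.cons true s : Fin (n + 1) → Bool) k = false
  refine ⟨Equiv.Perm.decomposeFin.symm (0, τ), S, ?_⟩
  rw [polytope, polytope, permuteCoords_image_convexHull, switchCoords_image_convexHull,
    Set.image_image, Set.image_image, Set.image_image]
  congr 1
  refine Set.image_congr fun b _ => ?_
  funext k
  refine Fin.cases ?_ (fun j => ?_) k
  · simp [pt, symmetry, switchCoords, permuteCoords, S]
  · cases h : s j <;> cases h' : b (τ j).succ <;>
      simp [pt, symmetry, switchCoords, permuteCoords, S, h, h']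

theorem IsCubeBased.exists_symmetry_of_combinatoriallyEquivalent {V W : Set (Fin (n + 1) → Bool)}
    (hV : IsCubeBased V) (hW : IsCubeBased W) (hn : 0 < n)
    (h : CombinatoriallyEquivalent (polytope V) (polytope W)) :
    ∃ τ s, W = symmetry τ s '' V := by
  obtain ⟨φ⟩ := h
  obtain ⟨f, hf⟩ := exists_vertex_equiv
    (((faceLatticeIso V).symm.trans φ).trans (faceLatticeIso W))
  exact hV.exists_symmetry hW hn f hf

theorem IsCubeBased.zeroOneEquivalent_iff {V W : Set (Fin (n + 1) → Bool)}
    (hV : IsCubeBased V) (hW : IsCubeBased W) (hn : 0 < n) :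
    ZeroOneEquivalent (polytope V) (polytope W) ↔
      CombinatoriallyEquivalent (polytope V) (polytope W) := by
  refine ⟨ZeroOneEquivalent.combinatoriallyEquivalent, fun h => ?_⟩
  obtain ⟨τ, s, rfl⟩ := hV.exists_symmetry_of_combinatoriallyEquivalent hW hn h
  obtain ⟨σ, S, h⟩ := polytope_symmetry_image τ s V
  rw [h]
  have h₁ : CubeStep (polytope V) (permuteCoords σ '' polytope V) := Or.inl ⟨σ, rfl⟩
  exact (Relation.ReflTransGen.single h₁).tail (Or.inr ⟨S, rfl⟩)

/-! ### Full dimension and the construction of cube-based sets -/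

theorem isZeroOnePolytope_polytope (V : Set (Fin d → Bool)) : IsZeroOnePolytope (polytope V) := by
  refine ⟨_, ?_, rfl⟩
  rintro _ ⟨b, -, rfl⟩ i
  cases h : b i <;> simp [pt, h]

theorem polytope_subset_Icc (V : Set (Fin d → Bool)) : polytope V ⊆ Set.Icc 0 1 := by
  refine convexHull_min ?_ (convex_Icc 0 1)
  rintro _ ⟨b, -, rfl⟩
  constructor <;> intro i <;> cases h : b i <;> simp [pt, h]

/-- Differences of flipped vertices are the standard basis vectors. -/
theorem isFullDimensional_of_exists_flip {V : Set (Fin d → Bool)} (hne : V.Nonempty)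
    (h : ∀ i, ∃ b ∈ V, b i = true ∧ flip i b ∈ V) : IsFullDimensional (polytope V) := by
  rw [IsFullDimensional, polytope, affineSpan_convexHull,
    AffineSubspace.affineSpan_eq_top_iff_vectorSpan_eq_top_of_nonempty ℝ _ _ (hne.image pt),
    eq_top_iff, ← (Pi.basisFun ℝ (Fin d)).span_eq, Submodule.span_le]
  rintro _ ⟨i, rfl⟩
  obtain ⟨b, hb, hi, hb'⟩ := h i
  have : (Pi.basisFun ℝ (Fin d)) i = pt b -ᵥ pt (flip i b) := by
    funext j
    rcases eq_or_ne j i with rfl | hj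
    · simp [pt, flip_self, hi]
    · simp [pt, flip_of_ne hj, hj]
  rw [this]
  exact vsub_mem_vectorSpan ℝ ⟨b, hb, rfl⟩ ⟨_, hb', rfl⟩

theorem IsCubeBased.isFullDimensional {V : Set (Fin (n + 1) → Bool)} (hV : IsCubeBased V)
    (hn : 0 < n) : IsFullDimensional (polytope V) := by
  refine isFullDimensional_of_exists_flip ⟨_, hV.bottom (fun _ => false) rfl⟩ fun i => ?_
  refine Fin.cases ?_ (fun j => ?_) i
  · obtain ⟨v, hvV, hv0, -⟩ := hV.exists_mem ⟨0, hn⟩ true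
    exact ⟨v, hvV, hv0, hV.bottom _ (by rw [flip_self, hv0]; rfl)⟩
  · refine ⟨Fin.cons false fun _ => true, hV.bottom _ rfl, rfl, hV.bottom _ ?_⟩
    rw [flip_of_ne (Fin.succ_ne_zero j).symm]
    rfl

/-- The bottom facet of the cube together with a copy of `U` in the top facet. -/
def prismSet (U : Finset (Fin n → Bool)) : Set (Fin (n + 1) → Bool) :=
  {b | b 0 = false ∨ Fin.tail b ∈ U}

theorem cons_true_mem_prismSet {U : Finset (Fin n → Bool)} {u : Fin n → Bool} :
    (Fin.cons true u : Fin (n + 1) → Bool) ∈ prismSet U ↔ u ∈ U := by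
  simp [prismSet]

theorem prismSet_injective : Function.Injective (prismSet (n := n)) := fun U U' h => by
  ext u
  rw [← cons_true_mem_prismSet, h, cons_true_mem_prismSet]

/-- At each coordinate, one member of an antipodal pair has any prescribed value. -/
theorem isCubeBased_prismSet {U : Finset (Fin n → Bool)} {u v : Fin n → Bool}
    (hu : u ∈ U) (hu' : (fun i => !u i) ∈ U) (hv : v ∉ U) (hv' : (fun i => !v i) ∉ U) :
    IsCubeBased (prismSet U) := by
  refine ⟨fun b hb => Or.inl hb, fun i e => ?_, fun i e => ?_⟩
  · by_cases h : u i = e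
    · exact ⟨_, cons_true_mem_prismSet.2 hu, rfl, h⟩
    · refine ⟨_, cons_true_mem_prismSet.2 hu', rfl, ?_⟩
      simpa [← Bool.eq_not_iff, eq_comm, Bool.not_eq_eq_eq_not] using h
  · by_cases h : v i = e
    · exact ⟨_, mt cons_true_mem_prismSet.1 hv, rfl, h⟩
    · refine ⟨_, mt cons_true_mem_prismSet.1 hv', rfl, ?_⟩
      simpa [← Bool.eq_not_iff, eq_comm, Bool.not_eq_eq_eq_not] using h

/-! ### Counting combinatorial types -/

/-- A finite set whose equivalence classes are small has many inequivalent elements. -/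
theorem exists_pairwise_not_of_card_class_le {α : Type*} (F : Finset α) (r : α → α → Prop)
    (hrefl : ∀ x, r x x) (hsymm : ∀ x y, r x y → r y x) (K : ℕ)
    (hK : ∀ x ∈ F, {y | y ∈ F ∧ r x y}.ncard ≤ K) :
    ∃ G ⊆ F, F.card ≤ G.card * K ∧ ∀ x ∈ G, ∀ y ∈ G, x ≠ y → ¬ r x y := by
  classical
  let I := F.powerset.filter fun G => ∀ x ∈ G, ∀ y ∈ G, x ≠ y → ¬ r x y
  -- By maximality the classes of the elements of `G` cover `F`; transitivity is not needed.
  obtain ⟨G, hG, hmax⟩ := I.exists_max_image Finset.card ⟨∅, by simp [I]⟩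
  simp only [I, Finset.mem_filter, Finset.mem_powerset] at hG hmax
  refine ⟨G, hG.1, ?_, hG.2⟩
  have hcover : F ⊆ G.biUnion fun x => F.filter (r x) := by
    intro y hy
    by_contra hn
    have hn' : ∀ x ∈ G, ¬ r x y := fun x hx hxy =>
      hn (Finset.mem_biUnion.2 ⟨x, hx, Finset.mem_filter.2 ⟨hy, hxy⟩⟩)
    have hyG : y ∉ G := fun h => hn' y h (hrefl y)
    have h := hmax (insert y G) ⟨Finset.insert_subset hy hG.1, ?_⟩
    · rw [Finset.card_insert_of_notMem hyG] at h
      omega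
    · intro a ha b hb hab
      rcases Finset.mem_insert.1 ha with rfl | ha' <;>
        rcases Finset.mem_insert.1 hb with rfl | hb'
      · exact absurd rfl hab
      · exact fun h => hn' b hb' (hsymm _ _ h)
      · exact hn' a ha'
      · exact hG.2 a ha' b hb' hab
  refine (Finset.card_le_card hcover).trans (Finset.card_biUnion_le_card_mul _ _ _ fun x hx => ?_)
  have h := hK x (hG.1 hx)
  rwa [← Finset.coe_filter, Set.ncard_coe_finset] at h

/-- The bound n! 2^n on a class, times 2^4 for the four fixed vertices. At n = 5 it reads 61440 <
65536; each further step multiplies the left side by 2(n + 1) and squares the right. -/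
theorem factorial_mul_two_pow_lt {n : ℕ} (hn : 5 ≤ n) :
    n.factorial * 2 ^ (n + 4) < 2 ^ 2 ^ (n - 1) := by
  induction n, hn using Nat.le_induction with
  | base => decide +kernel
  | succ n hn ih =>
    have h1 : 2 ^ (n + 1 - 1) = 2 ^ (n - 1) + 2 ^ (n - 1) := by
      obtain ⟨m, rfl⟩ : ∃ m, n = m + 1 := ⟨n - 1, by omega⟩
      simp [pow_succ, mul_two]
    have h2 : 2 * (n + 1) ≤ 2 ^ 2 ^ (n - 1) := by
      have h4 : n + 1 ≤ 2 ^ (n - 1) := by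
        clear ih h1
        induction n, hn using Nat.le_induction with
        | base => norm_num
        | succ m hm ihm =>
          have : 2 ^ (m + 1 - 1) = 2 ^ (m - 1) * 2 := by
            rw [← pow_succ]; congr 1; omega
          omega
      calc 2 * (n + 1) ≤ 2 * 2 ^ n := Nat.mul_le_mul_left 2 Nat.lt_two_pow_self
        _ = 2 ^ (n + 1) := by rw [pow_succ, mul_comm]
        _ ≤ 2 ^ 2 ^ (n - 1) := Nat.pow_le_pow_right two_pos h4
    rw [h1, pow_add 2 (2 ^ (n - 1))]
    calc (n + 1).factorial * 2 ^ (n + 1 + 4)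
        = (n.factorial * 2 ^ (n + 4)) * (2 * (n + 1)) := by
          rw [Nat.factorial_succ, show n + 1 + 4 = n + 4 + 1 by omega, pow_succ]; ring
      _ < 2 ^ 2 ^ (n - 1) * (2 * (n + 1)) := Nat.mul_lt_mul_of_pos_right ih (by omega)
      _ ≤ _ := Nat.mul_le_mul_left _ h2

theorem IsCubeBased.ncard_class_le {V : Set (Fin (n + 1) → Bool)} (hV : IsCubeBased V)
    (hn : 0 < n) (F : Finset (Set (Fin (n + 1) → ℝ)))
    (hF : ∀ P ∈ F, ∃ W, IsCubeBased W ∧ P = polytope W) :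
    {Q | Q ∈ F ∧ CombinatoriallyEquivalent (polytope V) Q}.ncard ≤ n.factorial * 2 ^ n := by
  have hsub : {Q | Q ∈ F ∧ CombinatoriallyEquivalent (polytope V) Q} ⊆
      Set.range fun p : Equiv.Perm (Fin n) × (Fin n → Bool) =>
        polytope (symmetry p.1 p.2 '' V) := by
    rintro Q ⟨hQ, h⟩
    obtain ⟨W, hW, rfl⟩ := hF Q hQ
    obtain ⟨τ, s, rfl⟩ := hV.exists_symmetry_of_combinatoriallyEquivalent hW hn h
    exact ⟨(τ, s), rfl⟩
  refine (Set.ncard_le_ncard hsub (Set.finite_range _)).trans ?_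
  rw [← Set.image_univ]
  refine (Set.ncard_image_le Set.finite_univ).trans ?_
  rw [Set.ncard_univ, Nat.card_eq_fintype_card]
  simp [Fintype.card_perm]

/-! ### The family -/

/-- Two antipodal pairs of vertices of the cube. -/
def antipodalPairs (m : ℕ) : Finset (Fin (m + 2) → Bool) :=
  {fun _ => false, fun _ => true, Fin.cons true fun _ => false, Fin.cons false fun _ => true}

/-- The first two bits already separate the four vectors. -/
theorem card_antipodalPairs (m : ℕ) : (antipodalPairs m).card = 4 := by
  have h (a b : Bool) (f : Fin (m + 2) → Bool) (h0 : f 0 = a) (h1 : f 1 = b)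
      (g : Fin (m + 2) → Bool) (h : g 0 ≠ a ∨ g 1 ≠ b) : f ≠ g := by
    rintro rfl
    simp_all
  rw [antipodalPairs, Finset.card_insert_of_notMem, Finset.card_insert_of_notMem,
    Finset.card_insert_of_notMem, Finset.card_singleton]
  · rw [Finset.mem_singleton]
    exact h true false _ rfl rfl _ (Or.inl (by simp))
  · simp only [Finset.mem_insert, Finset.mem_singleton, not_or]
    exact ⟨h true true _ rfl rfl _ (Or.inr Bool.false_ne_true),
      h true true _ rfl rfl _ (Or.inl (by simp))⟩
  · simp only [Finset.mem_insert, Finset.mem_singleton, not_or]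
    exact ⟨h false false _ rfl rfl _ (Or.inl (by simp)),
      h false false _ rfl rfl _ (Or.inl (by simp)),
      h false false _ rfl rfl _ (Or.inr Bool.false_ne_true.symm)⟩

/-- The vertex set with one antipodal pair present and one absent in the top facet. -/
def familySet {m : ℕ} (A : Finset (Fin (m + 2) → Bool)) : Set (Fin (m + 3) → Bool) :=
  prismSet ({fun _ => false, fun _ => true} ∪ A)

theorem isCubeBased_familySet {m : ℕ} {A : Finset (Fin (m + 2) → Bool)}
    (hA : A ⊆ (antipodalPairs m)ᶜ) : IsCubeBased (familySet A) := by
  have hA' : ∀ a ∈ A, a ∉ antipodalPairs m := fun a ha => Finset.mem_compl.1 (hA ha)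
  have hne (f g : Fin (m + 2) → Bool) (h : f 0 ≠ g 0 ∨ f 1 ≠ g 1) : f ≠ g := by
    rintro rfl
    simp at h
  have hnot : (fun i => !(Fin.cons true fun _ => false : Fin (m + 2) → Bool) i) =
      (Fin.cons false fun _ => true : Fin (m + 2) → Bool) := by
    funext i
    refine Fin.cases ?_ (fun j => ?_) i <;> simp
  refine isCubeBased_prismSet (u := fun _ => false)
    (v := (Fin.cons true fun _ => false : Fin (m + 2) → Bool)) (by simp) (by simp) ?_ ?_
  · simp only [Finset.mem_union, Finset.mem_insert, Finset.mem_singleton, not_or]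
    exact ⟨⟨hne _ _ (Or.inl (by simp)),
      hne _ _ (Or.inr Bool.false_ne_true)⟩,
      fun h => hA' _ h (by simp [antipodalPairs])⟩
  · rw [hnot]
    simp only [Finset.mem_union, Finset.mem_insert, Finset.mem_singleton, not_or]
    exact ⟨⟨hne _ _ (Or.inr Bool.false_ne_true.symm),
      hne _ _ (Or.inl (by simp))⟩,
      fun h => hA' _ h (by simp [antipodalPairs])⟩

/-- `A` avoids the pair that is always present, so removing that pair recovers `A`. -/
theorem injOn_polytope_familySet (m : ℕ) :
    Set.InjOn (fun A : Finset (Fin (m + 2) → Bool) => polytope (familySet A))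
      ↑(antipodalPairs m)ᶜ.powerset := by
  intro A hA A' hA' h
  have h' : ({fun _ => false, fun _ => true} ∪ A : Finset (Fin (m + 2) → Bool)) =
      {fun _ => false, fun _ => true} ∪ A' := prismSet_injective (polytope_injective h)
  have hdis : ∀ B ⊆ (antipodalPairs m)ᶜ,
      Disjoint ({fun _ => false, fun _ => true} : Finset (Fin (m + 2) → Bool)) B := by
    intro B hB
    refine Finset.disjoint_left.2 fun x hx hxB => Finset.mem_compl.1 (hB hxB) ?_
    simp only [Finset.mem_insert, Finset.mem_singleton] at hx
    rcases hx with rfl | rfl <;> simp [antipodalPairs]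
  have e := (hdis A (Finset.mem_powerset.1 hA)).sup_sdiff_cancel_left
  have e' := (hdis A' (Finset.mem_powerset.1 hA')).sup_sdiff_cancel_left
  rw [← e, ← e']
  exact congrArg (· \ _) h'

end ZeroOne

theorem mainTheorem1 (d : ℕ) (hd : 3 ≤ d) :
    ∃ 𝓕 : Finset (Set (Fin d → ℝ)),
      𝓕.card = 2 ^ (2 ^ (d - 1) - 4) ∧
      (∀ P ∈ 𝓕, ZeroOne.IsZeroOnePolytope P ∧ ZeroOne.IsFullDimensional P ∧
        P ⊆ Set.Icc 0 1) ∧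
      (∀ P ∈ 𝓕, ∀ Q ∈ 𝓕,
        ZeroOne.ZeroOneEquivalent P Q ↔ ZeroOne.CombinatoriallyEquivalent P Q) ∧
      (6 ≤ d → ∃ 𝓖 : Finset (Set (Fin d → ℝ)), 𝓖 ⊆ 𝓕 ∧
        2 ^ (2 ^ (d - 2)) < 𝓖.card ∧
        ∀ P ∈ 𝓖, ∀ Q ∈ 𝓖, P ≠ Q → ¬ ZeroOne.CombinatoriallyEquivalent P Q) := by
  classical
  obtain ⟨m, rfl⟩ : ∃ m, d = m + 3 := ⟨d - 3, by omega⟩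
  set 𝓕 : Finset (Set (Fin (m + 3) → ℝ)) :=
    (ZeroOne.antipodalPairs m)ᶜ.powerset.image fun A =>
      ZeroOne.polytope (ZeroOne.familySet A) with h𝓕
  have hmem : ∀ P ∈ 𝓕, ∃ V : Set (Fin (m + 2 + 1) → Bool),
      ZeroOne.IsCubeBased V ∧ P = ZeroOne.polytope V := by
    intro P hP
    obtain ⟨A, hA, rfl⟩ := Finset.mem_image.1 hP
    exact ⟨_, ZeroOne.isCubeBased_familySet (Finset.mem_powerset.1 hA), rfl⟩
  have hcard : 𝓕.card = 2 ^ (2 ^ (m + 2) - 4) := by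
    rw [h𝓕, Finset.card_image_of_injOn (ZeroOne.injOn_polytope_familySet m), Finset.card_powerset,
      Finset.card_compl, ZeroOne.card_antipodalPairs]
    simp
  refine ⟨𝓕, hcard, fun P hP => ?_, fun P hP Q hQ => ?_, fun h6 => ?_⟩
  · obtain ⟨V, hV, rfl⟩ := hmem P hP
    exact ⟨ZeroOne.isZeroOnePolytope_polytope V, hV.isFullDimensional (by omega),
      ZeroOne.polytope_subset_Icc V⟩
  · obtain ⟨V, hV, rfl⟩ := hmem P hP
    obtain ⟨W, hW, rfl⟩ := hmem Q hQ
    exact hV.zeroOneEquivalent_iff hW (by omega)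
  · obtain ⟨𝓖, hsub, hle, hpair⟩ := ZeroOne.exists_pairwise_not_of_card_class_le 𝓕
      ZeroOne.CombinatoriallyEquivalent ZeroOne.CombinatoriallyEquivalent.refl
      (fun _ _ => ZeroOne.CombinatoriallyEquivalent.symm) ((m + 2).factorial * 2 ^ (m + 2))
      (fun P hP => by
        obtain ⟨V, hV, rfl⟩ := hmem P hP
        exact hV.ncard_class_le (by omega) 𝓕 hmem)
    refine ⟨𝓖, hsub, ?_, hpair⟩
    show 2 ^ 2 ^ (m + 1) < 𝓖.card
    by_contra hlt
    have h1 := hle.trans (Nat.mul_le_mul_right _ (not_lt.1 hlt))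
    have h2 := ZeroOne.factorial_mul_two_pow_lt (n := m + 2) (by omega)
    rw [hcard] at h1
    -- Restoring the factor 2^4 makes the family size a square, so one root cancels against the
    -- assumed bound on `𝓖`.
    have h3 : 2 ^ (2 ^ (m + 2) - 4) * 2 ^ 4 = 2 ^ 2 ^ (m + 1) * 2 ^ 2 ^ (m + 1) := by
      have : 4 ≤ 2 ^ (m + 2) := Nat.pow_le_pow_right (n := 2) two_pos (show 2 ≤ m + 2 by omega)
      rw [← pow_add, ← pow_add]
      congr 1
      rw [pow_succ 2 (m + 1)] at this ⊢
      omega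
    have h4 : 2 ^ 2 ^ (m + 1) * 2 ^ 2 ^ (m + 1) ≤
        2 ^ 2 ^ (m + 1) * ((m + 2).factorial * 2 ^ (m + 2 + 4)) := by
      rw [← h3, pow_add 2 (m + 2) 4, ← mul_assoc, ← mul_assoc, mul_assoc _ _ (2 ^ (m + 2))]
      exact Nat.mul_le_mul_right _ h1
    exact absurd (Nat.le_of_mul_le_mul_left h4 (by positivity)) (not_le.2 h2)
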